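/- Let $(E,\|\cdot\|)$ be a real Banach space and let $\mathcal C\subset E$ be a proper closed convex cone, i.e. $\mathcal C$ is closed, convex, stable under multiplication by positive scalars, and $\mathcal C\cap(-\mathcal C)=\{0\}$. Let $\ell\in E'$ with $\|\ell\|=1$ and $K\in[1,\infty)$ satisfy $\langle\ell,\phi\rangle\ge\frac1K\|\phi\|$ for all $\phi\in\mathcal C$. Let $\rho\in(0,1]$ be such that $\mathcal C(\rho)=\{\phi\in\mathcal C: B(\phi,\rho\|\phi\|)\subset\mathcal C\}$ contains a non-zero vector, and let $\vartheta\in[1,\infty)$. Let $(\Omega,\mathcal F,\mathbb P)$ be a probability space and let $\tau:\Omega\to\Omega$ be an invertible bimeasurable, measure-preserving, ergodic map. A map $\Omega\to E$ is called Bochner measurable if it is a uniform limit of measurable maps with countable image (equivalently, if it is measurable with separable image). Let $(\mathcal L_\omega)_{\omega\in\Omega}$ be a family of bounded linear operators on $E$ such that * (uniform cone contraction) for every $\omega$, $\mathcal L_\omega(\mathcal C\setminus\{0\})\subset\mathcal C(\rho)\setminus\{0\}$ and $\frac1\vartheta\le\|\mathcal L_\omega\|\le\vartheta$; * (strong Bochner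 measurability) $\omega\mapsto\mathcal L_\omega x$ is Bochner measurable for every $x\in E$; * $\int_\Omega\bigl|\log\|\mathcal L_\omega\|\bigr|\,d\mathbb P(\omega)<\infty$. Then there is exactly one bounded Bochner measurable section $f=(f_\omega)_{\omega\in\Omega}$ with $f_\omega\in\mathcal C(\rho)$ and $\langle\ell,f_\omega\rangle=1$ for every $\omega$ such that $$f_\omega=\frac{\mathcal L_{\tau^{-1}\omega}f_{\tau^{-1}\omega}}{\langle\ell,\mathcal L_{\tau^{-1}\omega}f_{\tau^{-1}\omega}\rangle}\qquad\text{for every }\omega\in\Omega .$$ Moreover, with $p_\omega=\langle\ell,\mathcal L_{\tau^{-1}\omega}f_{\tau^{-1}\omega}\rangle$: 1. $p_\omega>0$ for every $\omega$, the function $\omega\mapsto p_\omega$ is measurable, and $\log p$ is $\mathbb P$-integrable. 2. For $\mathbb P$-almost every $\omega$, the characteristic exponent satisfies $$\chi_\omega:=\limsup_{n\to\infty}\frac1n\log\bigl\|\mathcal L_{\tau^{-1}\omega}\circ\cdots\circ\mathcal L_{\tau^{-n}\omega}\bigr\|=\int_\Omega\log p_{\omega'}\,d\mathbb P(\omega').$$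 -/

import Mathlib

open MeasureTheory Filter

noncomputable section

namespace ConeCocycle

/-- A proper closed convex cone (Birkhoff cone). -/
structure IsBirkhoffCone {E : Type*} [NormedAddCommGroup E] [NormedSpace ℝ E]
    (C : Set E) : Prop where
  smul_mem : ∀ t : ℝ, 0 < t → ∀ x ∈ C, t • x ∈ C
  isClosed : IsClosed C
  convex : Convex ℝ C
  mem_and_neg_mem_iff : ∀ x, (x ∈ C ∧ -x ∈ C) ↔ x = 0

/-- The sub-cone `C(ρ)` of all `φ ∈ C` with `B(φ, ρ‖φ‖) ⊆ C`. -/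
def subcone {E : Type*} [NormedAddCommGroup E] (C : Set E) (ρ : ℝ) : Set E :=
  {φ | φ ∈ C ∧ Metric.ball φ (ρ * ‖φ‖) ⊆ C}

/-- Outer regularity of `C`, with respect to the functional `ℓ` and the constant `K`. -/
structure IsOuterRegular {E : Type*} [NormedAddCommGroup E] [NormedSpace ℝ E]
    (C : Set E) (ℓ : E →L[ℝ] ℝ) (K : ℝ) : Prop where
  one_le : 1 ≤ K
  norm_eq_one : ‖ℓ‖ = 1
  le_apply : ∀ φ ∈ C, 1 / K * ‖φ‖ ≤ ℓ φ

/-- Inner regularity of `C` with constant `ρ`: the sub-cone `C(ρ)` is non-trivial. (The vector `0`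
always satisfies the ball condition, so the content is a non-zero element.) -/
structure IsInnerRegular {E : Type*} [NormedAddCommGroup E] (C : Set E) (ρ : ℝ) : Prop where
  pos : 0 < ρ
  le_one : ρ ≤ 1
  nontrivial : ∃ φ ∈ subcone C ρ, φ ≠ 0

/-- A uniform cone contraction: `A` maps `C \ {0}` into `C(ρ) \ {0}`, and its operator norm is
between `1 / ϑ` and `ϑ`. -/
structure IsUniformConeContraction {E : Type*} [NormedAddCommGroup E] [NormedSpace ℝ E]
    (C : Set E) (ρ ϑ : ℝ) (A : E →L[ℝ] E) : Prop where
  mapsTo : Set.MapsTo A (C \ {0}) (subcone C ρ \ {0})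
  le_norm : 1 / ϑ ≤ ‖A‖
  norm_le : ‖A‖ ≤ ϑ

/-- A family of bounded operators is strongly Bochner measurable if `ω ↦ A_ω x` is Bochner
measurable for every vector `x`. Bochner measurable maps (uniform limits of measurable maps with
countable image, equivalently measurable maps with separable image) are Mathlib's
`StronglyMeasurable` maps. -/
def StronglyBochnerMeasurable {Ω E : Type*} [MeasurableSpace Ω] [NormedAddCommGroup E]
    [NormedSpace ℝ E] (L : Ω → E →L[ℝ] E) : Prop :=
  ∀ x : E, StronglyMeasurable fun ω => L ω x

/-- The bounded Bochner measurable sections `φ : Ω → E` with `φ_ω ∈ C(ρ)` and `⟨ℓ, φ_ω⟩ = 1`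
for every `ω`. -/
def normalizedSections (Ω : Type*) [MeasurableSpace Ω] {E : Type*} [NormedAddCommGroup E]
    [NormedSpace ℝ E] (C : Set E) (ρ : ℝ) (ℓ : E →L[ℝ] ℝ) : Set (Ω → E) :=
  {φ | StronglyMeasurable φ ∧ (∃ R : ℝ, ∀ ω, ‖φ ω‖ ≤ R) ∧
    ∀ ω, φ ω ∈ subcone C ρ ∧ ℓ (φ ω) = 1}

/-- The bundle map `(L φ)_ω = L_{τ⁻¹ω} φ_{τ⁻¹ω}`. -/
def bundleMap {Ω E : Type*} [MeasurableSpace Ω] [NormedAddCommGroup E] [NormedSpace ℝ E]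
    (τ : Ω ≃ᵐ Ω) (L : Ω → E →L[ℝ] E) (φ : Ω → E) : Ω → E :=
  fun ω => L (τ.symm ω) (φ (τ.symm ω))

/-- The section of normalization factors `Λ(φ)_ω = ⟨ℓ, L_{τ⁻¹ω} φ_{τ⁻¹ω}⟩`. -/
def normalization {Ω E : Type*} [MeasurableSpace Ω] [NormedAddCommGroup E] [NormedSpace ℝ E]
    (τ : Ω ≃ᵐ Ω) (L : Ω → E →L[ℝ] E) (ℓ : E →L[ℝ] ℝ) (φ : Ω → E) : Ω → ℝ :=
  fun ω => ℓ (bundleMap τ L φ ω)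

/-- The fractional linear map `π(φ) = Λ(φ)⁻¹ L φ`. -/
def fractionalLinearMap {Ω E : Type*} [MeasurableSpace Ω] [NormedAddCommGroup E]
    [NormedSpace ℝ E] (τ : Ω ≃ᵐ Ω) (L : Ω → E →L[ℝ] E) (ℓ : E →L[ℝ] ℝ) (φ : Ω → E) : Ω → E :=
  fun ω => (normalization τ L ℓ φ ω)⁻¹ • bundleMap τ L φ ω

/-- The fibre operator `(Lⁿ)_ω = L_{τ⁻¹ω} ∘ ⋯ ∘ L_{τ⁻ⁿω}` of the `n`-th iterate. -/
def cocycle {Ω E : Type*} [MeasurableSpace Ω] [NormedAddCommGroup E] [NormedSpace ℝ E]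
    (τ : Ω ≃ᵐ Ω) (L : Ω → E →L[ℝ] E) : ℕ → Ω → E →L[ℝ] E
  | 0, _ => ContinuousLinearMap.id ℝ E
  | n + 1, ω => (L (τ.symm ω)).comp (cocycle τ L n (τ.symm ω))

/-- The characteristic exponent `χ_ω = limsup (1/n) log ‖(Lⁿ)_ω‖`, as an extended real number. -/
def charExponent {Ω E : Type*} [MeasurableSpace Ω] [NormedAddCommGroup E] [NormedSpace ℝ E]
    (τ : Ω ≃ᵐ Ω) (L : Ω → E →L[ℝ] E) (ω : Ω) : EReal :=
  limsup (fun n : ℕ => ((1 / (n : ℝ) * Real.log ‖cocycle τ L n ω‖ : ℝ) : EReal)) atTop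

end ConeCocycle

end

/-! A vector of `C(ρ)` sits so deep in the cone that, with `c = ρ / (2K)`, it dominates `c` times
any cone vector with the same `ℓ`-value (`sub_smul_mem_of_mem_subcone`). If `m • ψ ≤ φ ≤ M • ψ` in
the cone order, applying `L_ω` therefore allows both ends of the interval to be moved inwards, and
its length shrinks by the factor `1 - c` (`exists_order_interval_map`). Outer regularity turns this
into a norm estimate: the normalized `n`-step cocycle contracts at rate `(1 - c) ^ n`, uniformly in
the fibre (`norm_normalizedCocycle_sub_le`). Starting ever further in the past then gives a Cauchy
sequence in each fibre. Its limit is the fixed section, and the same estimate gives uniqueness.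

Along the fixed section the cocycle multiplies by the product of the factors `p`. An operator
preserving the cone has norm comparable to the `ℓ`-value of its image of a normalized vector of
`C(ρ)` (`norm_le_apply`), so `log ‖Lⁿ‖` differs from a Birkhoff sum of `log p` by a bounded amount.
Birkhoff's ergodic theorem for `τ⁻¹` identifies the exponent. -/

namespace ConeCocycle

open Topology

/-! ### Pointwise ergodic theorem via running maxima of Birkhoff sums -/

section Birkhoff

variable {Ω : Type*}

/-- The running maximum `max (0, S₁, …, Sₙ)` of the Birkhoff sums of `g` along `T`. -/
noncomputable def maxBirkhoffSum (T : Ω → Ω) (g : Ω → ℝ) : ℕ → Ω → ℝ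
  | 0, _ => 0
  | n + 1, x => max 0 (g x + maxBirkhoffSum T g n (T x))

lemma maxBirkhoffSum_nonneg (T : Ω → Ω) (g : Ω → ℝ) (n : ℕ) (x : Ω) :
    0 ≤ maxBirkhoffSum T g n x := by
  cases n with
  | zero => exact le_rfl
  | succ n => exact le_max_left _ _

lemma maxBirkhoffSum_le_succ (T : Ω → Ω) (g : Ω → ℝ) (n : ℕ) (x : Ω) :
    maxBirkhoffSum T g n x ≤ maxBirkhoffSum T g (n + 1) x := by
  induction n generalizing x with
  | zero => exact maxBirkhoffSum_nonneg T g 1 x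
  | succ n ih => exact max_le_max le_rfl (add_le_add le_rfl (ih (T x)))

lemma birkhoffSum_le_maxBirkhoffSum (T : Ω → Ω) (g : Ω → ℝ) (n : ℕ) (x : Ω) :
    birkhoffSum T g n x ≤ maxBirkhoffSum T g n x := by
  induction n generalizing x with
  | zero => simp [maxBirkhoffSum]
  | succ n ih =>
    rw [birkhoffSum_succ']
    exact (add_le_add le_rfl (ih (T x))).trans (le_max_right _ _)

lemma tendsto_atTop_maxBirkhoffSum {T : Ω → Ω} {g : Ω → ℝ} {x : Ω}
    (h : ∀ k : ℕ, ∃ n, (k : ℝ) < maxBirkhoffSum T g n x) :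
    Tendsto (fun n => maxBirkhoffSum T g n x) atTop atTop := by
  refine tendsto_atTop_mono' _ (.of_forall fun _ => le_rfl)
    (tendsto_atTop_atTop_of_monotone (monotone_nat_of_le_succ fun n =>
      maxBirkhoffSum_le_succ T g n x) fun b => ?_)
  obtain ⟨k, hk⟩ := exists_nat_ge b
  obtain ⟨n, hn⟩ := h k
  exact ⟨n, hk.trans hn.le⟩

lemma birkhoffSum_const_real (T : Ω → Ω) (a : ℝ) (n : ℕ) (x : Ω) :
    birkhoffSum T (fun _ => a) n x = n * a := by
  simp [birkhoffSum]

variable [MeasurableSpace Ω] {P : Measure Ω} {T : Ω → Ω} {g : Ω → ℝ}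

lemma measurable_maxBirkhoffSum (hT : Measurable T) (hg : Measurable g) (n : ℕ) :
    Measurable (maxBirkhoffSum T g n) := by
  induction n with
  | zero => exact measurable_const
  | succ n ih => exact measurable_const.max (hg.add (ih.comp hT))

lemma integrable_maxBirkhoffSum [IsFiniteMeasure P] (hT : MeasurePreserving T P P)
    (hg : Integrable g P) (n : ℕ) : Integrable (maxBirkhoffSum T g n) P := by
  induction n with
  | zero => exact integrable_zero _ _ _
  | succ n ih =>
    exact (integrable_zero _ _ _).sup (hg.add (hT.integrable_comp_of_integrable ih))

/-- If `g` has negative mean and `T` is ergodic, the Birkhoff sums of `g` are almost surely bounded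
above. -/
lemma ae_bddAbove_birkhoffSum [IsProbabilityMeasure P] (hT : Ergodic T P) (hg : Measurable g)
    (hgi : Integrable g P) (hneg : ∫ x, g x ∂P < 0) :
    ∀ᵐ x ∂P, ∃ k : ℕ, ∀ n, birkhoffSum T g n x ≤ k := by
  have hTm := hT.toMeasurePreserving
  set A : Set Ω := {x | ∀ k : ℕ, ∃ n, (k : ℝ) < maxBirkhoffSum T g n x} with hA
  have hAm : MeasurableSet A := by
    simp only [hA, Set.ofPred_forall, Set.ofPred_exists]
    exact .iInter fun k => .iUnion fun n =>
      measurableSet_lt measurable_const (measurable_maxBirkhoffSum hTm.measurable hg n)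
  -- The recursion changes the running maximum by `g x` only, so unboundedness at `x` and at `T x`
  -- are equivalent.
  have hinv : T ⁻¹' A = A := by
    ext x
    constructor
    · intro hx k
      obtain ⟨j, hj⟩ := exists_nat_ge ((k : ℝ) - g x)
      obtain ⟨n, hn⟩ := hx j
      refine ⟨n + 1, lt_of_lt_of_le ?_ (le_max_right _ _)⟩
      linarith
    · intro hx k
      obtain ⟨j, hj⟩ := exists_nat_ge (g x + k)
      obtain ⟨n, hn⟩ := hx j
      have hn' := hn.trans_le (maxBirkhoffSum_le_succ T g n x)
      refine ⟨n, ?_⟩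
      rcases lt_max_iff.1 hn' with h | h
      · exact absurd h (not_lt.2 (Nat.cast_nonneg j))
      · linarith
  rcases hT.toPreErgodic.ae_mem_or_ae_notMem hAm hinv with h | h
  · exfalso
    have hint := integrable_maxBirkhoffSum hTm hgi
    have hintT : ∀ n, Integrable (fun x => maxBirkhoffSum T g n (T x)) P := fun n =>
      hTm.integrable_comp_of_integrable (hint n)
    -- The integrand equals `max (-Mₙ(T x)) (g x)` with `Mₙ ≥ 0`: it is dominated by `|g|`, and
    -- equals `g x` once `Mₙ(T x) ≥ -g x`.
    have hlim : Tendsto (fun n => ∫ x, (maxBirkhoffSum T g (n + 1) x -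
        maxBirkhoffSum T g n (T x)) ∂P) atTop (𝓝 (∫ x, g x ∂P)) := by
      refine tendsto_integral_of_dominated_convergence (fun x => |g x|)
        (fun n => ((hint (n + 1)).sub (hintT n)).aestronglyMeasurable) hgi.abs
        (fun n => .of_forall fun x => ?_) ?_
      · have h0 := maxBirkhoffSum_nonneg T g n (T x)
        rw [Real.norm_eq_abs]
        change |max 0 (g x + maxBirkhoffSum T g n (T x)) - _| ≤ _
        rcases max_cases 0 (g x + maxBirkhoffSum T g n (T x)) with ⟨e, h⟩ | ⟨e, h⟩ <;> rw [e]
        · rw [zero_sub, abs_neg, abs_of_nonneg h0]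
          linarith [neg_le_abs (g x)]
        · simp
      · filter_upwards [h] with x hx
        have hx' : T x ∈ A := by rw [← hinv] at hx; exact hx
        refine tendsto_const_nhds.congr' ?_
        filter_upwards [(tendsto_atTop_maxBirkhoffSum hx').eventually_ge_atTop (-g x)] with n hn
        change _ = max 0 (g x + maxBirkhoffSum T g n (T x)) - _
        rw [max_eq_right (by linarith)]
        ring
    -- Invariance of `P` removes the `T`, and `Mₙ ≤ Mₙ₊₁`; the limit `∫ g` would then be
    -- nonnegative.
    have hnn : ∀ n, 0 ≤ ∫ x, (maxBirkhoffSum T g (n + 1) x - maxBirkhoffSum T g n (T x)) ∂P := by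
      intro n
      have e : ∫ x, maxBirkhoffSum T g n (T x) ∂P = ∫ x, maxBirkhoffSum T g n x ∂P := by
        have h1 := integral_map (μ := P) hTm.measurable.aemeasurable
          (f := maxBirkhoffSum T g n) (by rw [hTm.map_eq]; exact (hint n).aestronglyMeasurable)
        rw [hTm.map_eq] at h1
        exact h1.symm
      rw [integral_sub (hint (n + 1)) (hintT n), e, sub_nonneg]
      exact integral_mono (hint n) (hint (n + 1)) fun x => maxBirkhoffSum_le_succ T g n x
    exact absurd (ge_of_tendsto' hlim hnn) (not_le.2 hneg)
  · filter_upwards [h] with x hx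
    simp only [hA, Set.mem_ofPred_eq, not_forall, not_exists, not_lt] at hx
    obtain ⟨k, hk⟩ := hx
    exact ⟨k, fun n => (birkhoffSum_le_maxBirkhoffSum T g n x).trans (hk n)⟩

/-- Subtracting slightly more than the mean makes the mean negative, so the sums stay bounded above.
A second `1 / (j + 1)` per step absorbs the random bound `k` once `n ≥ k (j + 1)`. -/
lemma ae_eventually_birkhoffSum_le [IsProbabilityMeasure P] (hT : Ergodic T P)
    (hg : Measurable g) (hgi : Integrable g P) :
    ∀ᵐ x ∂P, ∀ j : ℕ, ∀ᶠ n : ℕ in atTop,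
      birkhoffSum T g n x ≤ n * (∫ y, g y ∂P + 2 / ((j : ℝ) + 1)) := by
  refine ae_all_iff.2 fun j => ?_
  have hj : 0 < 1 / ((j : ℝ) + 1) := by positivity
  set a := ∫ y, g y ∂P + 1 / ((j : ℝ) + 1) with ha
  have hneg : ∫ x, (g x - a) ∂P < 0 := by
    rw [integral_sub hgi (integrable_const _)]
    simp only [integral_const, probReal_univ, smul_eq_mul, one_mul]
    linarith
  filter_upwards [ae_bddAbove_birkhoffSum hT (hg.sub_const a)
    (hgi.sub (integrable_const a)) hneg] with x ⟨k, hk⟩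
  filter_upwards [(tendsto_natCast_atTop_atTop (R := ℝ)).eventually_ge_atTop
    (k * ((j : ℝ) + 1))] with n hn
  have h1 := hk n
  have h2 : birkhoffSum T (fun x => g x - a) n x = birkhoffSum T g n x - n * a := by
    rw [← birkhoffSum_const_real T a n x]
    exact birkhoffSum_sub T g (fun _ => a) n x
  have h3 : (k : ℝ) ≤ n * (1 / ((j : ℝ) + 1)) := by
    rw [mul_one_div, le_div_iff₀ (by positivity)]
    exact hn
  rw [h2] at h1
  have h4 : (n : ℝ) * (∫ y, g y ∂P + 2 / ((j : ℝ) + 1)) =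
      n * a + n * (1 / ((j : ℝ) + 1)) := by rw [ha]; ring
  linarith

/-- Birkhoff's pointwise ergodic theorem for an ergodic map of a probability space. -/
theorem ae_tendsto_birkhoffSum_div [IsProbabilityMeasure P] (hT : Ergodic T P)
    (hg : Measurable g) (hgi : Integrable g P) :
    ∀ᵐ x ∂P, Tendsto (fun n : ℕ => birkhoffSum T g n x / n) atTop (𝓝 (∫ y, g y ∂P)) := by
  filter_upwards [ae_eventually_birkhoffSum_le hT hg hgi,
    ae_eventually_birkhoffSum_le hT hg.neg hgi.neg] with x h1 h2
  rw [Metric.tendsto_atTop']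
  intro ε hε
  obtain ⟨j, hj⟩ := exists_nat_gt (2 / ε)
  have hj' : 2 / ((j : ℝ) + 1) < ε := by
    rw [div_lt_iff₀ (by positivity)]
    rw [div_lt_iff₀ hε] at hj
    nlinarith
  obtain ⟨N, hN⟩ := eventually_atTop.1 ((h1 j).and (h2 j))
  refine ⟨N, fun n hn => ?_⟩
  obtain ⟨h3, h4⟩ := hN n hn.le
  have hn0 : (0 : ℝ) < n := by exact_mod_cast (Nat.zero_le N).trans_lt hn
  have h5 : birkhoffSum T (-g) n x = -birkhoffSum T g n x := birkhoffSum_neg T g n x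
  have h6 : ∫ y, (-g) y ∂P = -∫ y, g y ∂P := integral_neg g
  rw [h5, h6] at h4
  rw [Real.dist_eq, abs_lt, lt_sub_iff_add_lt, sub_lt_iff_lt_add, lt_div_iff₀ hn0,
    div_lt_iff₀ hn0]
  constructor <;> nlinarith

end Birkhoff

/-! ### Cone geometry and the one-step contraction -/

section Cone

variable {E : Type*} [NormedAddCommGroup E] [NormedSpace ℝ E] {C : Set E} {ℓ : E →L[ℝ] ℝ}
  {K ρ : ℝ}

lemma IsBirkhoffCone.zero_mem (hC : IsBirkhoffCone C) : (0 : E) ∈ C :=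
  ((hC.mem_and_neg_mem_iff 0).2 rfl).1

lemma IsOuterRegular.pos (h : IsOuterRegular C ℓ K) : 0 < K := one_pos.trans_le h.one_le

lemma IsOuterRegular.norm_le (h : IsOuterRegular C ℓ K) {φ : E} (hφ : φ ∈ C) :
    ‖φ‖ ≤ K * ℓ φ := by
  have h1 := h.le_apply φ hφ
  rwa [one_div, inv_mul_le_iff₀ h.pos] at h1

lemma IsOuterRegular.apply_le_norm (h : IsOuterRegular C ℓ K) (φ : E) : ℓ φ ≤ ‖φ‖ := by
  have h1 := ℓ.le_opNorm φ
  rw [h.norm_eq_one, one_mul] at h1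
  exact (le_abs_self _).trans h1

lemma IsOuterRegular.apply_nonneg (h : IsOuterRegular C ℓ K) {φ : E} (hφ : φ ∈ C) :
    0 ≤ ℓ φ :=
  nonneg_of_mul_nonneg_right ((norm_nonneg φ).trans (h.norm_le hφ)) h.pos

lemma IsOuterRegular.apply_pos (h : IsOuterRegular C ℓ K) {φ : E} (hφ : φ ∈ C \ {0}) :
    0 < ℓ φ :=
  pos_of_mul_pos_right ((norm_pos_iff.2 hφ.2).trans_le (h.norm_le hφ.1)) h.pos.le

lemma IsBirkhoffCone.zero_mem_subcone (hC : IsBirkhoffCone C) : (0 : E) ∈ subcone C ρ :=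
  ⟨hC.zero_mem, by simp⟩

lemma IsBirkhoffCone.smul_mem_subcone (hC : IsBirkhoffCone C) {t : ℝ} (ht : 0 < t) {x : E}
    (hx : x ∈ subcone C ρ) : t • x ∈ subcone C ρ := by
  refine ⟨hC.smul_mem t ht x hx.1, fun y hy => ?_⟩
  have h : t⁻¹ • y ∈ C := by
    apply hx.2
    rw [mem_ball_iff_norm] at hy ⊢
    have e : t⁻¹ • y - x = t⁻¹ • (y - t • x) := by
      rw [smul_sub, smul_smul, inv_mul_cancel₀ ht.ne', one_smul]
    rw [e, norm_smul, Real.norm_of_nonneg (inv_nonneg.2 ht.le), inv_mul_lt_iff₀ ht]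
    rw [norm_smul, Real.norm_of_nonneg ht.le] at hy
    linarith
  simpa [smul_smul, ht.ne'] using hC.smul_mem t ht _ h

lemma IsBirkhoffCone.isClosed_subcone (hC : IsBirkhoffCone C) : IsClosed (subcone C ρ) := by
  refine isClosed_of_closure_subset fun x hx => ?_
  obtain ⟨u, hu, hux⟩ := mem_closure_iff_seq_limit.1 hx
  refine ⟨hC.isClosed.mem_of_tendsto hux (.of_forall fun n => (hu n).1), fun y hy => ?_⟩
  have h1 : Tendsto (fun n => dist y (u n)) atTop (𝓝 (dist y x)) :=
    tendsto_const_nhds.dist hux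
  have h2 : Tendsto (fun n => ρ * ‖u n‖) atTop (𝓝 (ρ * ‖x‖)) := hux.norm.const_mul ρ
  obtain ⟨n, hn⟩ := (h1.eventually_lt h2 hy).exists
  exact (hu n).2 hn

lemma map_mem_subcone (hC : IsBirkhoffCone C) {A : E →L[ℝ] E}
    (hA : Set.MapsTo A (C \ {0}) (subcone C ρ \ {0})) {x : E} (hx : x ∈ C) :
    A x ∈ subcone C ρ := by
  by_cases h : x = 0
  · rw [h, map_zero]; exact hC.zero_mem_subcone
  · exact (hA ⟨hx, h⟩).1

/-- Elements of `C(ρ)` dominate every element of the cone, up to a uniform factor. -/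
lemma sub_smul_mem_of_mem_subcone (hC : IsBirkhoffCone C) (h : IsOuterRegular C ℓ K)
    (hρ : 0 < ρ) {φ ψ : E} (hφ : φ ∈ subcone C ρ) (hψ : ψ ∈ C \ {0}) :
    φ - (ρ / (2 * K) * (ℓ φ / ℓ ψ)) • ψ ∈ C := by
  by_cases h0 : φ = 0
  · simpa [h0] using hC.zero_mem
  have hK := h.pos
  have hψ0 := h.apply_pos hψ
  have hφ0 := h.apply_nonneg hφ.1
  have hn : 0 < ‖φ‖ := norm_pos_iff.2 h0
  -- The ball in `C(ρ)` is open; the 2 in `ρ / (2K)` provides the strict inequality.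
  apply hφ.2
  rw [mem_ball_iff_norm, sub_sub_cancel_left, norm_neg, norm_smul,
    Real.norm_of_nonneg (by positivity)]
  calc ρ / (2 * K) * (ℓ φ / ℓ ψ) * ‖ψ‖ ≤ ρ / (2 * K) * (‖φ‖ / ℓ ψ) * (K * ℓ ψ) := by
        gcongr
        · exact h.apply_le_norm φ
        · exact h.norm_le hψ.1
    _ = ρ / 2 * ‖φ‖ := by field_simp
    _ < ρ * ‖φ‖ := by gcongr; linarith

/-- One step of the Birkhoff contraction: the order interval of `φ` relative to `ψ` shrinks by the
factor `1 - ρ / (2K)`. -/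
lemma exists_order_interval_map (hC : IsBirkhoffCone C) (h : IsOuterRegular C ℓ K)
    (hρ : 0 < ρ) {A : E →L[ℝ] E} (hA : Set.MapsTo A (C \ {0}) (subcone C ρ \ {0}))
    {φ ψ : E} (hψ : ψ ∈ C \ {0}) {m M : ℝ} (hm : φ - m • ψ ∈ C) (hM : M • ψ - φ ∈ C) :
    ∃ m' M' : ℝ, m ≤ m' ∧ M' - m' = (1 - ρ / (2 * K)) * (M - m) ∧
      A φ - m' • A ψ ∈ C ∧ M' • A ψ - A φ ∈ C := by
  have hK := h.pos
  have hAψ : A ψ ∈ C \ {0} := ⟨(hA hψ).1.1, (hA hψ).2⟩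
  have hpos := h.apply_pos hAψ
  have h1 := map_mem_subcone hC hA hm
  have h2 := map_mem_subcone hC hA hM
  -- The shifts are the multiples of `A ψ` dominated by the images of the two gaps. The `ℓ`-values
  -- of these images add up to `(M - m) * ℓ (A ψ)`, whence the exact factor.
  refine ⟨m + ρ / (2 * K) * (ℓ (A (φ - m • ψ)) / ℓ (A ψ)),
    M - ρ / (2 * K) * (ℓ (A (M • ψ - φ)) / ℓ (A ψ)), ?_, ?_, ?_, ?_⟩
  · have := h.apply_nonneg h1.1
    have : 0 ≤ ρ / (2 * K) * (ℓ (A (φ - m • ψ)) / ℓ (A ψ)) := by positivity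
    linarith
  · simp only [map_sub, map_smul, smul_eq_mul]
    field_simp
    ring
  · have := sub_smul_mem_of_mem_subcone hC h hρ h1 hAψ
    convert this using 1
    simp only [map_sub, map_smul, add_smul]
    abel
  · have := sub_smul_mem_of_mem_subcone hC h hρ h2 hAψ
    convert this using 1
    simp only [map_sub, map_smul, sub_smul]
    abel

/-- The remainder `x - m • y` lies in the cone, so its norm is at most `K` times its `ℓ`-value,
itself at most `(M - m) * ℓ y`, while `ℓ x ≥ m * ℓ y`. -/
lemma norm_normalize_sub_le (h : IsOuterRegular C ℓ K) {x y : E}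
    (hy : y ∈ C \ {0}) {m M : ℝ} (hm0 : 0 < m) (hm : x - m • y ∈ C) (hM : M • y - x ∈ C) :
    ‖(ℓ x)⁻¹ • x - (ℓ y)⁻¹ • y‖ ≤ 2 * K * ((M - m) / m) := by
  have hK := h.pos
  have hy0 := h.apply_pos hy
  have h1 := h.apply_nonneg hm
  have h2 := h.apply_nonneg hM
  have h3 := h.norm_le hm
  have h4 := h.norm_le hy.1
  simp only [map_sub, map_smul, smul_eq_mul] at h1 h2 h3
  have hx0 : 0 < ℓ x := by nlinarith [mul_pos hm0 hy0]
  have e : (ℓ x)⁻¹ • x - (ℓ y)⁻¹ • y =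
      (ℓ x)⁻¹ • ((x - m • y) - ((ℓ x - m * ℓ y) / ℓ y) • y) := by
    have e1 : (ℓ x)⁻¹ * ((ℓ x - m * ℓ y) / ℓ y) = (ℓ y)⁻¹ - (ℓ x)⁻¹ * m := by
      field_simp
    rw [smul_sub, smul_sub, smul_smul, smul_smul, e1, sub_smul]
    abel
  rw [e, norm_smul, Real.norm_of_nonneg (by positivity)]
  have h5 : ‖((ℓ x - m * ℓ y) / ℓ y) • y‖ ≤ K * (ℓ x - m * ℓ y) := by
    rw [norm_smul, Real.norm_of_nonneg (by positivity)]
    calc (ℓ x - m * ℓ y) / ℓ y * ‖y‖ ≤ (ℓ x - m * ℓ y) / ℓ y * (K * ℓ y) := by gcongr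
      _ = _ := by field_simp
  calc (ℓ x)⁻¹ * ‖(x - m • y) - ((ℓ x - m * ℓ y) / ℓ y) • y‖
      ≤ (ℓ x)⁻¹ * (2 * K * (ℓ x - m * ℓ y)) := by
        gcongr
        exact (norm_sub_le _ _).trans (by linarith)
    _ = 2 * K * ((ℓ x - m * ℓ y) / ℓ x) := by ring
    _ ≤ 2 * K * (((M - m) * ℓ y) / (m * ℓ y)) := by
        refine mul_le_mul_of_nonneg_left (div_le_div₀ ?_ ?_ (by positivity) ?_) (by positivity) <;>
          linarith
    _ = _ := by rw [mul_div_mul_right _ _ hy0.ne']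

/-- Operators preserving the cone have norm controlled by their value on an interior vector. -/
lemma norm_le_apply (h : IsOuterRegular C ℓ K) (hρ : 0 < ρ) {A : E →L[ℝ] E}
    (hA : Set.MapsTo A C C) {φ : E} (hφ : φ ∈ subcone C ρ) (hφ1 : ℓ φ = 1) :
    ‖A‖ ≤ 3 * K / ρ * ℓ (A φ) := by
  have hK := h.pos
  have hφn : 1 ≤ ‖φ‖ := hφ1 ▸ h.apply_le_norm φ
  have hp := h.apply_nonneg (hA hφ.1)
  -- Both `φ ± x` lie in `C`: the minus sign gives `ℓ (A x) ≤ ℓ (A φ)`, so `A φ + A x` and `A φ`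
  -- have norms at most `2K` and `K` times `ℓ (A φ)`.
  have key : ∀ x : E, ‖x‖ < ρ → ‖A x‖ ≤ 3 * K * ℓ (A φ) := by
    intro x hx
    have hx' : ‖x‖ < ρ * ‖φ‖ := by nlinarith
    have h1 : φ + x ∈ C := hφ.2 (by simpa [mem_ball_iff_norm] using hx')
    have h2 : φ - x ∈ C := hφ.2 (by simpa [mem_ball_iff_norm] using hx')
    have h3 := h.norm_le (hA h1)
    have h4 := h.apply_nonneg (hA h2)
    have h5 := h.norm_le (hA hφ.1)
    simp only [map_add, map_sub] at h3 h4
    have h6 : ‖A x‖ ≤ ‖A φ + A x‖ + ‖A φ‖ := by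
      have := norm_sub_le (A φ + A x) (A φ)
      rwa [add_sub_cancel_left] at this
    nlinarith
  have hbound : ∀ r : ℝ, 0 < r → r < ρ → ‖A‖ ≤ 3 * K * ℓ (A φ) / r := by
    intro r hr hrρ
    refine A.opNorm_le_bound (by positivity) fun x => ?_
    by_cases hx : x = 0
    · simp [hx]
    have hxn : 0 < ‖x‖ := norm_pos_iff.2 hx
    have h1 := key ((r / ‖x‖) • x) (by
      rw [norm_smul, Real.norm_of_nonneg (by positivity), div_mul_cancel₀ _ hxn.ne']
      exact hrρ)
    rw [map_smul, norm_smul, Real.norm_of_nonneg (by positivity), div_mul_eq_mul_div,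
      div_le_iff₀ hxn] at h1
    rw [div_mul_eq_mul_div, le_div_iff₀ hr]
    linarith
  have hlim : Tendsto (fun r : ℝ => 3 * K * ℓ (A φ) / r) (𝓝[<] ρ)
      (𝓝 (3 * K * ℓ (A φ) / ρ)) :=
    (tendsto_const_nhds.div tendsto_id hρ.ne').mono_left nhdsWithin_le_nhds
  have := ge_of_tendsto hlim (by
    filter_upwards [Ioo_mem_nhdsLT hρ] with r hr using hbound r hr.1 hr.2)
  calc ‖A‖ ≤ 3 * K * ℓ (A φ) / ρ := this
    _ = _ := by ring

end Cone

/-! ### Applying a strongly measurable operator family to a section -/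

section Measurability

variable {Ω E : Type*} [MeasurableSpace Ω] [NormedAddCommGroup E] [NormedSpace ℝ E]

lemma StronglyBochnerMeasurable.apply_simpleFunc {L : Ω → E →L[ℝ] E}
    (hL : StronglyBochnerMeasurable L) (g : SimpleFunc Ω E) :
    StronglyMeasurable fun ω => L ω (g ω) := by
  classical
  induction g using SimpleFunc.induction with
  | const c hs =>
    rename_i s
    convert (hL c).indicator hs using 1
    ext ω
    by_cases h : ω ∈ s <;> simp [h]
  | add _ hf hg => simpa using hf.fun_add hg

lemma StronglyBochnerMeasurable.apply {L : Ω → E →L[ℝ] E}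
    (hL : StronglyBochnerMeasurable L) {g : Ω → E} (hg : StronglyMeasurable g) :
    StronglyMeasurable fun ω => L ω (g ω) :=
  stronglyMeasurable_of_tendsto atTop (fun n => hL.apply_simpleFunc (hg.approx n))
    (tendsto_pi_nhds.2 fun ω => ((L ω).continuous.tendsto _).comp (hg.tendsto_approx ω))

lemma StronglyBochnerMeasurable.bundleMap {L : Ω → E →L[ℝ] E}
    (hL : StronglyBochnerMeasurable L) (τ : Ω ≃ᵐ Ω) {g : Ω → E} (hg : StronglyMeasurable g) :
    StronglyMeasurable (bundleMap τ L g) :=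
  (hL.apply hg).comp_measurable τ.symm.measurable

end Measurability

/-! ### The cocycle and its action on the cone -/

section Cocycle

variable {Ω E : Type*} [MeasurableSpace Ω] [NormedAddCommGroup E] [NormedSpace ℝ E]
  {C : Set E} {ℓ : E →L[ℝ] ℝ} {K ρ : ℝ} {τ : Ω ≃ᵐ Ω} {L : Ω → E →L[ℝ] E}

lemma cocycle_add_apply (n k : ℕ) (ω : Ω) (x : E) :
    cocycle τ L (n + k) ω x = cocycle τ L n ω (cocycle τ L k (τ.symm^[n] ω) x) := by
  induction n generalizing ω with
  | zero => simp [cocycle]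
  | succ n ih =>
    rw [Nat.add_right_comm, Function.iterate_succ_apply]
    exact congrArg (L (τ.symm ω)) (ih (τ.symm ω))

lemma cocycle_mapsTo_diff (hA : ∀ ω, Set.MapsTo (L ω) (C \ {0}) (subcone C ρ \ {0}))
    (n : ℕ) (ω : Ω) : Set.MapsTo (cocycle τ L n ω) (C \ {0}) (C \ {0}) := by
  induction n generalizing ω with
  | zero => exact Set.mapsTo_id _
  | succ n ih =>
    intro x hx
    have h := hA (τ.symm ω) (ih (τ.symm ω) hx)
    exact ⟨h.1.1, h.2⟩

lemma cocycle_mapsTo (hC : IsBirkhoffCone C)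
    (hA : ∀ ω, Set.MapsTo (L ω) (C \ {0}) (subcone C ρ \ {0}))
    (n : ℕ) (ω : Ω) : Set.MapsTo (cocycle τ L n ω) C C := by
  intro x hx
  by_cases h : x = 0
  · rw [h, map_zero]; exact hC.zero_mem
  · exact (cocycle_mapsTo_diff hA n ω ⟨hx, h⟩).1

lemma cocycle_mem_subcone (hC : IsBirkhoffCone C)
    (hA : ∀ ω, Set.MapsTo (L ω) (C \ {0}) (subcone C ρ \ {0}))
    (n : ℕ) (ω : Ω) {x : E} (hx : x ∈ subcone C ρ) : cocycle τ L n ω x ∈ subcone C ρ := by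
  cases n with
  | zero => exact hx
  | succ n => exact map_mem_subcone hC (hA _) (cocycle_mapsTo hC hA n _ hx.1)

lemma StronglyBochnerMeasurable.cocycle_apply (hL : StronglyBochnerMeasurable L) (n : ℕ) (x : E) :
    StronglyMeasurable fun ω => cocycle τ L n ω x := by
  induction n with
  | zero => exact stronglyMeasurable_const
  | succ n ih => exact hL.bundleMap τ ih

/-- The image of `x` under the fibre operator `(Lⁿ)_ω`, rescaled so that `ℓ` takes the value `1`. -/
noncomputable def normalizedCocycle (τ : Ω ≃ᵐ Ω) (L : Ω → E →L[ℝ] E) (ℓ : E →L[ℝ] ℝ) (n : ℕ)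
    (ω : Ω) (x : E) : E :=
  (ℓ (cocycle τ L n ω x))⁻¹ • cocycle τ L n ω x

lemma normalizedCocycle_smul {t : ℝ} (ht : t ≠ 0) (n : ℕ) (ω : Ω) (x : E) :
    normalizedCocycle τ L ℓ n ω (t • x) = normalizedCocycle τ L ℓ n ω x := by
  simp only [normalizedCocycle, map_smul, smul_smul, smul_eq_mul, mul_inv]
  rw [mul_right_comm, inv_mul_cancel₀ ht, one_mul]

/-! ### Exponential contraction of the normalized cocycle -/

section Contraction

variable (hC : IsBirkhoffCone C) (h : IsOuterRegular C ℓ K) (hρ : 0 < ρ)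
  (hA : ∀ ω, Set.MapsTo (L ω) (C \ {0}) (subcone C ρ \ {0}))

lemma ne_zero_of_apply_eq_one {x : E} (hx : ℓ x = 1) : x ≠ 0 := by
  rintro rfl
  simp at hx

include h hA in
lemma apply_cocycle_pos (n : ℕ) (ω : Ω) {x : E} (hx : x ∈ C) (hx1 : ℓ x = 1) :
    0 < ℓ (cocycle τ L n ω x) :=
  h.apply_pos (cocycle_mapsTo_diff hA n ω ⟨hx, ne_zero_of_apply_eq_one hx1⟩)

include h hA in
lemma apply_normalizedCocycle (n : ℕ) (ω : Ω) {x : E} (hx : x ∈ C) (hx1 : ℓ x = 1) :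
    ℓ (normalizedCocycle τ L ℓ n ω x) = 1 := by
  rw [normalizedCocycle, map_smul, smul_eq_mul,
    inv_mul_cancel₀ (apply_cocycle_pos h hA n ω hx hx1).ne']

include hC h hA in
lemma normalizedCocycle_mem_subcone (n : ℕ) (ω : Ω) {x : E} (hx : x ∈ subcone C ρ)
    (hx1 : ℓ x = 1) : normalizedCocycle τ L ℓ n ω x ∈ subcone C ρ :=
  hC.smul_mem_subcone (inv_pos.2 (apply_cocycle_pos h hA n ω hx.1 hx1))
    (cocycle_mem_subcone hC hA n ω hx)

include hC h hρ hA in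
lemma exists_order_interval_cocycle (n : ℕ) (ω : Ω) {φ ψ : E} (hψ : ψ ∈ C \ {0}) {m M : ℝ}
    (hm : φ - m • ψ ∈ C) (hM : M • ψ - φ ∈ C) :
    ∃ m' M' : ℝ, m ≤ m' ∧ M' - m' = (1 - ρ / (2 * K)) ^ n * (M - m) ∧
      cocycle τ L n ω φ - m' • cocycle τ L n ω ψ ∈ C ∧
      M' • cocycle τ L n ω ψ - cocycle τ L n ω φ ∈ C := by
  induction n generalizing ω with
  | zero => exact ⟨m, M, le_rfl, by simp, hm, hM⟩
  | succ n ih =>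
    obtain ⟨m₁, M₁, h1, h2, h3, h4⟩ := ih (τ.symm ω)
    obtain ⟨m₂, M₂, h5, h6, h7, h8⟩ := exists_order_interval_map hC h hρ (hA (τ.symm ω))
      (cocycle_mapsTo_diff hA n (τ.symm ω) hψ) h3 h4
    exact ⟨m₂, M₂, h1.trans h5, by rw [h6, h2]; ring, h7, h8⟩

include hC h hρ hA in
/-- Uniform exponential contraction of the normalized cocycle. -/
lemma norm_normalizedCocycle_sub_le (hρ1 : ρ ≤ 1) (n : ℕ) (ω : Ω) {φ ψ : E}
    (hφ : φ ∈ subcone C ρ) (hψ : ψ ∈ subcone C ρ) (hφ1 : ℓ φ = 1) (hψ1 : ℓ ψ = 1) :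
    ‖normalizedCocycle τ L ℓ n ω φ - normalizedCocycle τ L ℓ n ω ψ‖ ≤
      2 * K / (ρ / (2 * K)) ^ 2 * (1 - ρ / (2 * K)) ^ n := by
  have hK := h.pos
  set c := ρ / (2 * K) with hc
  have hc0 : 0 < c := by positivity
  have hc1 : c ≤ 1 := by
    rw [hc, div_le_one (by positivity)]
    linarith [h.one_le]
  have hψ' : ψ ∈ C \ {0} := ⟨hψ.1, ne_zero_of_apply_eq_one hψ1⟩
  have hm := sub_smul_mem_of_mem_subcone hC h hρ hφ hψ'
  -- Domination in both directions gives the initial interval `[c, c⁻¹]`.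
  have hM := hC.smul_mem c⁻¹ (by positivity) _ (sub_smul_mem_of_mem_subcone hC h hρ hψ
    (⟨hφ.1, ne_zero_of_apply_eq_one hφ1⟩ : φ ∈ C \ {0}))
  rw [hφ1, hψ1, div_one, mul_one, ← hc] at hm hM
  rw [smul_sub, smul_smul, inv_mul_cancel₀ hc0.ne', one_smul] at hM
  obtain ⟨m', M', h1, h2, h3, h4⟩ := exists_order_interval_cocycle (τ := τ) hC h hρ hA n ω hψ' hm hM
  rw [← hc] at h2
  have hm' : 0 < m' := hc0.trans_le h1
  have hp : 0 ≤ (1 - c) ^ n := pow_nonneg (by linarith) n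
  refine (norm_normalize_sub_le h (cocycle_mapsTo_diff hA n ω hψ') hm' h3 h4).trans ?_
  calc 2 * K * ((M' - m') / m') ≤ 2 * K * ((1 - c) ^ n * c⁻¹ / c) := by
        rw [h2]
        refine mul_le_mul_of_nonneg_left (div_le_div₀ (by positivity) ?_ hc0 h1) (by positivity)
        exact mul_le_mul_of_nonneg_left (by linarith) hp
    _ = 2 * K / c ^ 2 * (1 - c) ^ n := by field_simp

lemma normalizedCocycle_add (n k : ℕ) (ω : Ω) (x : E)
    (hx : ℓ (cocycle τ L k (τ.symm^[n] ω) x) ≠ 0) :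
    normalizedCocycle τ L ℓ (n + k) ω x =
      normalizedCocycle τ L ℓ n ω (normalizedCocycle τ L ℓ k (τ.symm^[n] ω) x) := by
  rw [normalizedCocycle.eq_1 τ L ℓ k, normalizedCocycle_smul (inv_ne_zero hx),
    normalizedCocycle, normalizedCocycle, cocycle_add_apply]

end Contraction

lemma fractionalLinearMap_normalizedCocycle (n : ℕ) (ω : Ω) (x : E)
    (hx : ℓ (cocycle τ L n (τ.symm ω) x) ≠ 0) :
    fractionalLinearMap τ L ℓ (fun ω' => normalizedCocycle τ L ℓ n ω' x) ω =
      normalizedCocycle τ L ℓ (n + 1) ω x := by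
  simp only [fractionalLinearMap, normalization, bundleMap, normalizedCocycle, map_smul,
    smul_smul, smul_eq_mul, mul_inv, inv_inv]
  rw [mul_right_comm, mul_inv_cancel₀ hx, one_mul]
  rfl

/-! ### The fixed section and the characteristic exponent -/

section FixedSection

variable {f : Ω → E}

lemma normalization_pos (h : IsOuterRegular C ℓ K)
    (hA : ∀ ω, Set.MapsTo (L ω) (C \ {0}) (subcone C ρ \ {0}))
    (hf : f ∈ normalizedSections Ω C ρ ℓ) (ω : Ω) : 0 < normalization τ L ℓ f ω := by
  obtain ⟨h1, h2⟩ := hf.2.2 (τ.symm ω)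
  have h3 := hA (τ.symm ω) ⟨h1.1, ne_zero_of_apply_eq_one h2⟩
  exact h.apply_pos ⟨h3.1.1, h3.2⟩

/-- Along a fixed section of the fractional linear map the cocycle acts by multiplication with the
product of the normalization factors. -/
lemma cocycle_apply_fixed (hpos : ∀ ω, 0 < normalization τ L ℓ f ω)
    (hfix : fractionalLinearMap τ L ℓ f = f) (n : ℕ) (ω : Ω) :
    cocycle τ L n ω (f (τ.symm^[n] ω)) =
      Real.exp (birkhoffSum τ.symm (fun ω => Real.log (normalization τ L ℓ f ω)) n ω) • f ω := by
  induction n generalizing ω with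
  | zero => simp [cocycle]
  | succ n ih =>
    have h1 : L (τ.symm ω) (f (τ.symm ω)) = normalization τ L ℓ f ω • f ω := by
      have h2 : (normalization τ L ℓ f ω)⁻¹ • bundleMap τ L f ω = f ω := congrFun hfix ω
      rw [← h2, smul_smul, mul_inv_cancel₀ (hpos ω).ne', one_smul]
      rfl
    rw [Function.iterate_succ_apply, birkhoffSum_succ', Real.exp_add, Real.exp_log (hpos ω)]
    change L (τ.symm ω) (cocycle τ L n (τ.symm ω) (f (τ.symm^[n] (τ.symm ω)))) = _
    rw [ih, map_smul, h1, smul_smul, mul_comm]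

lemma normalizedCocycle_apply_fixed (hpos : ∀ ω, 0 < normalization τ L ℓ f ω)
    (hfix : fractionalLinearMap τ L ℓ f = f) (hf1 : ∀ ω, ℓ (f ω) = 1) (n : ℕ) (ω : Ω) :
    normalizedCocycle τ L ℓ n ω (f (τ.symm^[n] ω)) = f ω := by
  rw [normalizedCocycle, cocycle_apply_fixed hpos hfix, map_smul, hf1, smul_eq_mul, mul_one,
    smul_smul, inv_mul_cancel₀ (Real.exp_pos _).ne', one_smul]

lemma contraction_factor_mem (h : IsOuterRegular C ℓ K) (hρ : 0 < ρ) (hρ1 : ρ ≤ 1) :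
    0 ≤ 1 - ρ / (2 * K) ∧ 1 - ρ / (2 * K) < 1 := by
  have hK := h.pos
  have h1 : ρ / (2 * K) ≤ 1 := by
    rw [div_le_one (by positivity)]
    linarith [h.one_le]
  have h2 : 0 < ρ / (2 * K) := by positivity
  constructor <;> linarith

/-- Both values at `ω` are images under one normalized `n`-step map from the fibre over `τ⁻ⁿω`,
hence exponentially close for every `n`. -/
theorem fixed_section_unique (hC : IsBirkhoffCone C) (h : IsOuterRegular C ℓ K) (hρ : 0 < ρ)
    (hρ1 : ρ ≤ 1) (hA : ∀ ω, Set.MapsTo (L ω) (C \ {0}) (subcone C ρ \ {0})) {g : Ω → E}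
    (hf : f ∈ normalizedSections Ω C ρ ℓ) (hffix : fractionalLinearMap τ L ℓ f = f)
    (hg : g ∈ normalizedSections Ω C ρ ℓ) (hgfix : fractionalLinearMap τ L ℓ g = g) :
    f = g := by
  funext ω
  obtain ⟨hr0, hr1⟩ := contraction_factor_mem h hρ hρ1
  have hlim := (tendsto_pow_atTop_nhds_zero_of_lt_one hr0 hr1).const_mul
    (2 * K / (ρ / (2 * K)) ^ 2)
  rw [mul_zero] at hlim
  rw [← sub_eq_zero, ← norm_le_zero_iff]
  refine ge_of_tendsto' hlim fun n => ?_
  have h1 := norm_normalizedCocycle_sub_le (τ := τ) hC h hρ hA hρ1 n ω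
    (hf.2.2 (τ.symm^[n] ω)).1 (hg.2.2 (τ.symm^[n] ω)).1 (hf.2.2 _).2 (hg.2.2 _).2
  rwa [normalizedCocycle_apply_fixed (normalization_pos h hA hf) hffix fun ω => (hf.2.2 ω).2,
    normalizedCocycle_apply_fixed (normalization_pos h hA hg) hgfix fun ω => (hg.2.2 ω).2] at h1

theorem exists_fixed_section [CompleteSpace E] (hC : IsBirkhoffCone C) (h : IsOuterRegular C ℓ K)
    (hin : IsInnerRegular C ρ) (hA : ∀ ω, Set.MapsTo (L ω) (C \ {0}) (subcone C ρ \ {0}))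
    (hLm : StronglyBochnerMeasurable L) :
    ∃ f ∈ normalizedSections Ω C ρ ℓ, fractionalLinearMap τ L ℓ f = f := by
  obtain ⟨e, he, he1⟩ : ∃ e ∈ subcone C ρ, ℓ e = 1 := by
    obtain ⟨φ, hφ, hφ0⟩ := hin.nontrivial
    have hp := h.apply_pos ⟨hφ.1, hφ0⟩
    exact ⟨(ℓ φ)⁻¹ • φ, hC.smul_mem_subcone (inv_pos.2 hp) hφ, by simp [hp.ne']⟩
  have hpos := fun n ω => apply_cocycle_pos (τ := τ) h hA n ω he.1 he1
  obtain ⟨hr0, hr1⟩ := contraction_factor_mem h hin.pos hin.le_one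
  have hcauchy : ∀ ω, CauchySeq fun n => normalizedCocycle τ L ℓ n ω e := by
    intro ω
    refine cauchySeq_of_le_geometric _ (2 * K / (ρ / (2 * K)) ^ 2) hr1 fun n => ?_
    -- The extra step is the earliest one, so consecutive terms are images of two normalized vectors
    -- under the same `n`-step map.
    rw [normalizedCocycle_add n 1 ω e (hpos 1 _).ne', dist_eq_norm]
    exact norm_normalizedCocycle_sub_le hC h hin.pos hA hin.le_one n ω he
      (normalizedCocycle_mem_subcone hC h hA 1 _ he he1) he1
      (apply_normalizedCocycle h hA 1 _ he.1 he1)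
  choose f hf using fun ω => cauchySeq_tendsto_of_complete (hcauchy ω)
  have hmem : ∀ ω, f ω ∈ subcone C ρ := fun ω => hC.isClosed_subcone.mem_of_tendsto (hf ω)
    (.of_forall fun n => normalizedCocycle_mem_subcone hC h hA n ω he he1)
  have hone : ∀ ω, ℓ (f ω) = 1 := fun ω => by
    refine tendsto_nhds_unique ((ℓ.continuous.tendsto _).comp (hf ω)) ?_
    refine tendsto_const_nhds.congr fun n => ?_
    exact (apply_normalizedCocycle h hA n ω he.1 he1).symm
  have hmeas : StronglyMeasurable f := by
    refine stronglyMeasurable_of_tendsto atTop (fun n => ?_) (tendsto_pi_nhds.2 hf)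
    have h1 := hLm.cocycle_apply (τ := τ) n e
    exact ((ℓ.continuous.comp_stronglyMeasurable h1).measurable.inv.stronglyMeasurable).smul h1
  have hsec : f ∈ normalizedSections Ω C ρ ℓ := by
    refine ⟨hmeas, ⟨K, fun ω => ?_⟩, fun ω => ⟨hmem ω, hone ω⟩⟩
    have := h.norm_le (hmem ω).1
    rwa [hone ω, mul_one] at this
  refine ⟨f, hsec, funext fun ω => ?_⟩
  have h1 : Tendsto (fun n => bundleMap τ L (fun ω' => normalizedCocycle τ L ℓ n ω' e) ω) atTop
      (𝓝 (bundleMap τ L f ω)) :=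
    ((L (τ.symm ω)).continuous.tendsto _).comp (hf (τ.symm ω))
  have h2 : Tendsto (fun n => fractionalLinearMap τ L ℓ
      (fun ω' => normalizedCocycle τ L ℓ n ω' e) ω) atTop (𝓝 (fractionalLinearMap τ L ℓ f ω)) :=
    (((ℓ.continuous.tendsto _).comp h1).inv₀ (normalization_pos h hA hsec ω).ne').smul h1
  refine tendsto_nhds_unique h2 (((tendsto_add_atTop_iff_nat 1).2 (hf ω)).congr fun n => ?_)
  exact (fractionalLinearMap_normalizedCocycle n ω e (hpos n _).ne').symm

lemma measurable_normalization (hLm : StronglyBochnerMeasurable L) (hf : StronglyMeasurable f) :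
    Measurable (normalization τ L ℓ f) :=
  (ℓ.continuous.comp_stronglyMeasurable (hLm.bundleMap τ hf)).measurable

lemma norm_le_of_mem_normalizedSections (h : IsOuterRegular C ℓ K)
    (hf : f ∈ normalizedSections Ω C ρ ℓ) (ω : Ω) : ‖f ω‖ ≤ K := by
  have := h.norm_le (hf.2.2 ω).1.1
  rwa [(hf.2.2 ω).2, mul_one] at this

lemma integrable_log_normalization {P : Measure Ω} [IsFiniteMeasure P] {ϑ : ℝ}
    (hC : IsBirkhoffCone C) (h : IsOuterRegular C ℓ K) (hρ : 0 < ρ) (hϑ : 1 ≤ ϑ)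
    (hL : ∀ ω, IsUniformConeContraction C ρ ϑ (L ω)) (hLm : StronglyBochnerMeasurable L)
    (hf : f ∈ normalizedSections Ω C ρ ℓ) :
    Integrable (fun ω => Real.log (normalization τ L ℓ f ω)) P := by
  have hK := h.pos
  have hϑ0 : 0 < ϑ := one_pos.trans_le hϑ
  have hlo : 0 < ρ / (3 * K * ϑ) := by positivity
  -- The bounds come from `1 / ϑ ≤ ‖L‖ ≤ (3K / ρ) p` and `p ≤ ‖L‖ ‖f‖ ≤ ϑ K`.
  refine Integrable.of_mem_Icc (Real.log (ρ / (3 * K * ϑ))) (Real.log (ϑ * K))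
    (measurable_normalization hLm hf.1).log.aemeasurable (.of_forall fun ω => ?_)
  have hp := normalization_pos (τ := τ) h (fun ω => (hL ω).mapsTo) hf ω
  obtain ⟨h1, h2⟩ := hf.2.2 (τ.symm ω)
  constructor
  · refine Real.log_le_log hlo ?_
    have h3 := (hL (τ.symm ω)).le_norm.trans (norm_le_apply h hρ
      (fun x hx => (map_mem_subcone hC (hL (τ.symm ω)).mapsTo hx).1) h1 h2)
    change 1 / ϑ ≤ 3 * K / ρ * normalization τ L ℓ f ω at h3
    calc ρ / (3 * K * ϑ) = ρ / (3 * K) * (1 / ϑ) := by field_simp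
      _ ≤ ρ / (3 * K) * (3 * K / ρ * normalization τ L ℓ f ω) := by gcongr
      _ = normalization τ L ℓ f ω := by field_simp
  · refine Real.log_le_log hp ((h.apply_le_norm _).trans (((L (τ.symm ω)).le_opNorm _).trans ?_))
    exact mul_le_mul (hL _).norm_le (norm_le_of_mem_normalizedSections h hf _) (norm_nonneg _)
      hϑ0.le

/-- The growth of the cocycle is that of the product of the normalization factors, up to a bounded
factor. -/
lemma log_norm_cocycle_mem_Icc (hC : IsBirkhoffCone C) (h : IsOuterRegular C ℓ K) (hρ : 0 < ρ)
    (hA : ∀ ω, Set.MapsTo (L ω) (C \ {0}) (subcone C ρ \ {0}))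
    (hf : f ∈ normalizedSections Ω C ρ ℓ) (hfix : fractionalLinearMap τ L ℓ f = f)
    (n : ℕ) (ω : Ω) :
    Real.log ‖cocycle τ L n ω‖ ∈ Set.Icc
      (birkhoffSum τ.symm (fun ω => Real.log (normalization τ L ℓ f ω)) n ω - Real.log K)
      (birkhoffSum τ.symm (fun ω => Real.log (normalization τ L ℓ f ω)) n ω +
        Real.log (3 * K / ρ)) := by
  have hK := h.pos
  set S := birkhoffSum τ.symm (fun ω => Real.log (normalization τ L ℓ f ω)) n ω
  have e : ℓ (cocycle τ L n ω (f (τ.symm^[n] ω))) = Real.exp S := by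
    rw [cocycle_apply_fixed (normalization_pos h hA hf) hfix, map_smul, (hf.2.2 ω).2,
      smul_eq_mul, mul_one]
  obtain ⟨h1, h2⟩ := hf.2.2 (τ.symm^[n] ω)
  have hup := norm_le_apply h hρ (cocycle_mapsTo (τ := τ) hC hA n ω) h1 h2
  have hlo : Real.exp S ≤ ‖cocycle τ L n ω‖ * K := by
    rw [← e]
    refine (h.apply_le_norm _).trans (((cocycle τ L n ω).le_opNorm _).trans ?_)
    gcongr
    exact norm_le_of_mem_normalizedSections h hf _
  rw [e] at hup
  have hn : 0 < ‖cocycle τ L n ω‖ := pos_of_mul_pos_left ((Real.exp_pos S).trans_le hlo) hK.le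
  constructor
  · have := Real.log_le_log (Real.exp_pos S) hlo
    rw [Real.log_exp, Real.log_mul hn.ne' hK.ne'] at this
    linarith
  · have := Real.log_le_log hn hup
    rw [Real.log_mul (by positivity) (Real.exp_pos S).ne', Real.log_exp] at this
    linarith

lemma charExponent_eq_of_tendsto (hC : IsBirkhoffCone C) (h : IsOuterRegular C ℓ K) (hρ : 0 < ρ)
    (hA : ∀ ω, Set.MapsTo (L ω) (C \ {0}) (subcone C ρ \ {0}))
    (hf : f ∈ normalizedSections Ω C ρ ℓ) (hfix : fractionalLinearMap τ L ℓ f = f)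
    {ω : Ω} {a : ℝ} (ha : Tendsto (fun n : ℕ => birkhoffSum τ.symm
      (fun ω => Real.log (normalization τ L ℓ f ω)) n ω / n) atTop (𝓝 a)) :
    charExponent τ L ω = (a : EReal) := by
  have hb := log_norm_cocycle_mem_Icc hC h hρ hA hf hfix
  have hlim : Tendsto (fun n : ℕ => 1 / (n : ℝ) * Real.log ‖cocycle τ L n ω‖) atTop (𝓝 a) := by
    have h1 := ha.sub (tendsto_const_div_atTop_nhds_zero_nat (Real.log K))
    have h2 := ha.add (tendsto_const_div_atTop_nhds_zero_nat (Real.log (3 * K / ρ)))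
    rw [sub_zero] at h1
    rw [add_zero] at h2
    refine tendsto_of_tendsto_of_tendsto_of_le_of_le h1 h2 (fun n => ?_) fun n => ?_
    · simp only
      rw [← sub_div, one_div_mul_eq_div]
      exact div_le_div_of_nonneg_right (hb n ω).1 n.cast_nonneg
    · simp only
      rw [← add_div, one_div_mul_eq_div]
      exact div_le_div_of_nonneg_right (hb n ω).2 n.cast_nonneg
  exact ((continuous_coe_real_ereal.tendsto a).comp hlim).limsup_eq

end FixedSection

end Cocycle

end ConeCocycle

theorem mainTheorem6
    {E : Type*} [NormedAddCommGroup E] [NormedSpace ℝ E] [CompleteSpace E]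
    {Ω : Type*} [MeasurableSpace Ω] (P : Measure Ω) [IsProbabilityMeasure P]
    (τ : Ω ≃ᵐ Ω) (hτ : Ergodic τ P)
    (C : Set E) (ℓ : E →L[ℝ] ℝ) (K ρ ϑ : ℝ)
    (hC : ConeCocycle.IsBirkhoffCone C)
    (houter : ConeCocycle.IsOuterRegular C ℓ K)
    (hinner : ConeCocycle.IsInnerRegular C ρ)
    (hϑ : 1 ≤ ϑ)
    (L : Ω → E →L[ℝ] E)
    (hL : ∀ ω, ConeCocycle.IsUniformConeContraction C ρ ϑ (L ω))
    (hLmeas : ConeCocycle.StronglyBochnerMeasurable L)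
    (hLint : ∫⁻ ω, ENNReal.ofReal |Real.log ‖L ω‖| ∂P < ⊤) :
    (∃! f : Ω → E, f ∈ ConeCocycle.normalizedSections Ω C ρ ℓ ∧
      ConeCocycle.fractionalLinearMap τ L ℓ f = f) ∧
    ∀ f ∈ ConeCocycle.normalizedSections Ω C ρ ℓ,
      ConeCocycle.fractionalLinearMap τ L ℓ f = f →
      ((∀ ω, 0 < ConeCocycle.normalization τ L ℓ f ω) ∧
        Measurable (ConeCocycle.normalization τ L ℓ f) ∧
        Integrable (fun ω => Real.log (ConeCocycle.normalization τ L ℓ f ω)) P) ∧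
      ∀ᵐ ω ∂P, ConeCocycle.charExponent τ L ω =
        ((∫ ω', Real.log (ConeCocycle.normalization τ L ℓ f ω') ∂P : ℝ) : EReal) := by
  have hA : ∀ ω, Set.MapsTo (L ω) (C \ {0}) (ConeCocycle.subcone C ρ \ {0}) :=
    fun ω => (hL ω).mapsTo
  refine ⟨?_, fun f hf hfix => ?_⟩
  · obtain ⟨f, hf, hfix⟩ := ConeCocycle.exists_fixed_section (τ := τ) hC houter hinner hA hLmeas
    exact ⟨f, ⟨hf, hfix⟩, fun g hg => ConeCocycle.fixed_section_unique hC houter hinner.pos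
      hinner.le_one hA hg.1 hg.2 hf hfix⟩
  · have hmeas := ConeCocycle.measurable_normalization (τ := τ) (ℓ := ℓ) hLmeas hf.1
    have hint := ConeCocycle.integrable_log_normalization (P := P) (τ := τ) hC houter hinner.pos hϑ
      hL hLmeas hf
    refine ⟨⟨ConeCocycle.normalization_pos houter hA hf, hmeas, hint⟩, ?_⟩
    -- The cocycle runs into the past, so ergodicity of `τ⁻¹` is what is used.
    filter_upwards [ConeCocycle.ae_tendsto_birkhoffSum_div hτ.symm hmeas.log hint] with ω hω
    exact ConeCocycle.charExponent_eq_of_tendsto hC houter hinner.pos hA hf hfix hω
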